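/- An \emph{involutive bisemilattice} is an algebra $\langle B,\cdot,+,{}',0,1\rangle$ of type $(2,2,1,0,0)$ satisfying $x+x=x$; $x+y=y+x$; $x+(y+z)=(x+y)+z$; $(x')'=x$; $x\cdot y=(x'+y')'$; $x\cdot(x'+y)=x\cdot y$; $0+x=x$; $1=0'$. Let $\mathfrak{IBSL}$ be the category whose objects are involutive bisemilattices and whose morphisms are the maps preserving all the operations $\cdot,+,{}',0,1$. A \emph{Stone space} is a compact, Hausdorff, totally disconnected topological space (possibly empty); let $\mathfrak{SA}$ be the category of Stone spaces and continuous maps. A \emph{semilattice inverse system of Stone spaces} is a triple $\langle X_i,p_{ii'},I\rangle$ where $I$ is a join semilattice with a least element, $X_i$ is a Stone space for each $i\in I$, and for each pair $i\le i'$ in $I$ there is a continuous map $p_{ii'}:X_{i'}\to X_i$, such that $p_{ii}$ is the identity of $X_i$ and $p_{ii'}\circ p_{i'i''}=p_{ii''}$ whenever $i\le i'\le i''$. A morphism from $\langle X_i,p_{ii'},I\rangle$ to $\langle Y_j,q_{jj'},J\rangle$ is a pair $(\varphi,(f_j)_{j\in J})$ where $\varphi:J\to I$ preserves binary joins and the least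 element, and each $f_j:X_{\varphi(j)}\to Y_j$ is continuous, such that $f_j\circ p_{\varphi(j)\varphi(j')}=q_{jj'}\circ f_{j'}$ whenever $j\le j'$. The composite of $(\varphi,(f_j)_{j\in J})$ followed by a morphism $(\psi,(g_k)_{k\in K})$ to a third system with index set $K$ is $(\varphi\circ\psi,(g_k\circ f_{\psi(k)})_{k\in K})$. These data form the category Sem-inv-$\mathfrak{SA}$. Theorem. The categories $\mathfrak{IBSL}$ and Sem-inv-$\mathfrak{SA}$ are dually equivalent; that is, there is an equivalence of categories between $\mathfrak{IBSL}^{\mathrm{op}}$ and Sem-inv-$\mathfrak{SA}$. -/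

import Mathlib

open CategoryTheory

universe w v u

/-- Involutive bisemilattices: algebras of type `(2,2,1,0,0)`, with operations
`·`, `+`, an involution (written `xᶜ`), `0` and `1`. -/
class InvolutiveBisemilattice (α : Type u) extends Add α, Mul α, Compl α, Zero α, One α where
  add_self (x : α) : x + x = x
  add_comm (x y : α) : x + y = y + x
  add_assoc (x y z : α) : x + (y + z) = (x + y) + z
  compl_compl (x : α) : xᶜᶜ = x
  mul_eq (x y : α) : x * y = (xᶜ + yᶜ)ᶜ
  mul_compl_add (x y : α) : x * (xᶜ + y) = x * y
  zero_add (x : α) : 0 + x = x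
  one_eq : (1 : α) = 0ᶜ

/-- Homomorphisms of involutive bisemilattices: maps preserving all the operations. -/
@[ext]
structure InvolutiveBisemilatticeHom (α β : Type u)
    [InvolutiveBisemilattice α] [InvolutiveBisemilattice β] where
  toFun : α → β
  map_add (x y : α) : toFun (x + y) = toFun x + toFun y
  map_mul (x y : α) : toFun (x * y) = toFun x * toFun y
  map_compl (x : α) : toFun xᶜ = (toFun x)ᶜ
  map_zero : toFun 0 = 0
  map_one : toFun 1 = 1

/-- The objects of the category of involutive bisemilattices. -/
structure IBSL : Type (u + 1) where
  carrier : Type u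
  [str : InvolutiveBisemilattice carrier]

attribute [instance] IBSL.str

/-- The category of involutive bisemilattices and their homomorphisms. -/
instance IBSL.category : Category.{u} IBSL.{u} where
  Hom A B := InvolutiveBisemilatticeHom A.carrier B.carrier
  id A :=
    { toFun := fun x => x
      map_add := fun _ _ => rfl
      map_mul := fun _ _ => rfl
      map_compl := fun _ => rfl
      map_zero := rfl
      map_one := rfl }
  comp f g :=
    { toFun := fun x => g.toFun (f.toFun x)
      map_add := fun x y => by rw [f.map_add, g.map_add]
      map_mul := fun x y => by rw [f.map_mul, g.map_mul]
      map_compl := fun x => by rw [f.map_compl, g.map_compl]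
      map_zero := by rw [f.map_zero, g.map_zero]
      map_one := by rw [f.map_one, g.map_one] }

/-- A semilattice inverse system in a category `C`: a join semilattice `Index` with least
element, an object `obj i` of `C` for every index `i`, and a bonding morphism
`bond h : obj j ⟶ obj i` for every `h : i ≤ j`, functorially. -/
structure SemInv (C : Type u) [Category.{v} C] : Type (max u v (w + 1)) where
  Index : Type w
  [semilatticeSup : SemilatticeSup Index]
  [orderBot : OrderBot Index]
  obj : Index → C
  bond {i j : Index} (h : i ≤ j) : obj j ⟶ obj i
  bond_refl (i : Index) : bond (le_refl i) = 𝟙 (obj i)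
  bond_trans {i j k : Index} (hij : i ≤ j) (hjk : j ≤ k) :
    bond hjk ≫ bond hij = bond (hij.trans hjk)

attribute [instance] SemInv.semilatticeSup SemInv.orderBot

namespace SemInv

variable {C : Type u} [Category.{v} C]

/-- A morphism of semilattice inverse systems from `X` to `Y`: a homomorphism `index` of join
semilattices with least element (preserving binary joins and the least element) from the index
set of `Y` to that of `X`, with morphisms `app j : X.obj (index j) ⟶ Y.obj j` commuting with the
bonding morphisms. -/
@[ext]
structure Hom (X Y : SemInv.{w, v, u} C) : Type (max v w) where
  index : SupBotHom Y.Index X.Index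
  app (j : Y.Index) : X.obj (index j) ⟶ Y.obj j
  naturality {j j' : Y.Index} (h : j ≤ j') :
    X.bond (OrderHomClass.mono index h) ≫ app j = app j' ≫ Y.bond h

/-- The identity morphism of a semilattice inverse system. -/
def Hom.id (X : SemInv.{w, v, u} C) : Hom X X where
  index := SupBotHom.id X.Index
  app j := 𝟙 (X.obj j)
  naturality h := (Category.comp_id (X.bond h)).trans (Category.id_comp (X.bond h)).symm

/-- The composition of morphisms of semilattice inverse systems. -/
def Hom.comp {X Y Z : SemInv.{w, v, u} C} (f : Hom X Y) (g : Hom Y Z) : Hom X Z where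
  index := f.index.comp g.index
  app k := f.app (g.index k) ≫ g.app k
  naturality {k k'} h := by
    have h1 := f.naturality (OrderHomClass.mono g.index h)
    have h2 := g.naturality h
    calc _ = (X.bond (OrderHomClass.mono f.index (OrderHomClass.mono g.index h)) ≫
            f.app (g.index k)) ≫ g.app k := (Category.assoc _ _ _).symm
      _ = (f.app (g.index k') ≫ g.app k') ≫ Z.bond h := by
        rw [h1, Category.assoc, h2, Category.assoc]

/-- The category of semilattice inverse systems in `C`. -/
instance category : Category.{max v w} (SemInv.{w, v, u} C) where
  Hom X Y := Hom X Y
  id X := Hom.id X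
  comp f g := Hom.comp f g
  id_comp _ := Hom.ext rfl (heq_of_eq (funext fun _ => Category.id_comp _))
  comp_id _ := Hom.ext rfl (heq_of_eq (funext fun _ => Category.comp_id _))
  assoc _ _ _ := Hom.ext rfl (heq_of_eq (funext fun _ => Category.assoc _ _ _))

end SemInv

/-! Every involutive bisemilattice is a Płonka sum of Boolean algebras. The elements `0 * x` form a
join semilattice under `+`; the elements with zero part `e` form a Boolean algebra with bottom `e`;
and `x ↦ x + f` maps the fibre over `e` to the fibre over `f` when `e ≤ f`. This works because
absorption fails only by a zero part (`add_mul_self`, `mul_one_add`), and `x + y` and `x * y` have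
the same zero part.

The equivalence sends an inverse system to the Płonka sum of its clopen algebras. It is fully
faithful because the operations remember the indices (through `a * aᶜ`) and the bonding maps
(through adding a bottom element), while Stone duality recovers the continuous maps. It is
essentially surjective because Stone's representation theorem applies to each fibre
(`toClopenSum_bijective`). -/

namespace InvolutiveBisemilattice

/-! ### Arithmetic of zero parts. -/

variable {α : Type u} [InvolutiveBisemilattice α]

instance : Std.Commutative (α := α) (· + ·) := ⟨add_comm⟩
instance : Std.Associative (α := α) (· + ·) := ⟨fun x y z => (add_assoc x y z).symm⟩

theorem compl_add (x y : α) : (x + y)ᶜ = xᶜ * yᶜ := by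
  rw [mul_eq, compl_compl, compl_compl]

theorem compl_mul (x y : α) : (x * y)ᶜ = xᶜ + yᶜ := by
  rw [mul_eq, compl_compl]

theorem compl_zero : (0 : α)ᶜ = 1 := one_eq.symm

theorem mul_self (x : α) : x * x = x := by rw [mul_eq, add_self, compl_compl]

theorem mul_comm (x y : α) : x * y = y * x := by rw [mul_eq, mul_eq, add_comm]

theorem mul_assoc (x y z : α) : x * (y * z) = (x * y) * z := by
  simp only [mul_eq, compl_compl, add_assoc]

instance : Std.Commutative (α := α) (· * ·) := ⟨mul_comm⟩
instance : Std.Associative (α := α) (· * ·) := ⟨fun x y z => (mul_assoc x y z).symm⟩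

theorem add_zero (x : α) : x + 0 = x := by rw [add_comm, zero_add]

theorem add_compl_mul (x y : α) : x + xᶜ * y = x + y := by
  have h := congrArg (·ᶜ) (mul_compl_add xᶜ yᶜ)
  simpa only [compl_mul, compl_add, compl_compl] using h

theorem compl_mul_add (x y : α) : xᶜ * (x + y) = xᶜ * y := by
  simpa only [compl_compl] using mul_compl_add xᶜ y

theorem mul_compl_self (x : α) : x * xᶜ = 0 * x := by
  simpa only [add_zero, mul_comm x 0] using mul_compl_add x 0

theorem zero_mul_compl (x : α) : 0 * xᶜ = 0 * x := by
  rw [← mul_compl_self, ← mul_compl_self, compl_compl, mul_comm]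

theorem zero_mul_zero_mul (x : α) : 0 * (0 * x) = 0 * x := by rw [mul_assoc, mul_self]

/-- Since `x + z = x + xᶜ * z`, both sides reduce to `x + 0 * (x * y)`. -/
theorem add_mul_self (x y : α) : x + x * y = x + 0 * y := by
  have h1 : x + x * y = x + 0 * (x * y) := by
    rw [← add_compl_mul x (x * y), mul_assoc, mul_comm xᶜ, mul_compl_self, mul_assoc]
  have h2 : x + 0 * y = x + 0 * (x * y) := by
    rw [← add_compl_mul x (0 * y), mul_assoc, mul_comm xᶜ, zero_mul_compl, mul_assoc]
  rw [h1, h2]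

theorem mul_add_self (x y : α) : x * (x + y) = x * (1 + y) := by
  have h := congrArg (·ᶜ) (add_mul_self xᶜ yᶜ)
  simpa only [compl_mul, compl_add, compl_compl, compl_zero] using h

theorem one_add_eq_compl (y : α) : 1 + y = (0 * y)ᶜ := by
  rw [← zero_mul_compl, compl_mul, compl_zero, compl_compl]

theorem mul_one_add (x y : α) : x * (1 + y) = x + 0 * y := by
  -- For `z = x * (1 + y)`, the product `z * (0 * y)` is exactly `0 * z`, so adding `0 * y` to `z`
  -- adds only the zero part of `z`.
  have h1 : x * (1 + y) + 0 * y = x * (1 + y) + 0 * (x * (1 + y)) := by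
    have h : 0 * (x * (1 + y)) = x * (0 * y) := by
      rw [one_add_eq_compl, mul_comm x, mul_assoc, zero_mul_compl, zero_mul_zero_mul, mul_comm]
    have h' : x * (1 + y) * (0 * y) = x * (0 * y) := by
      rw [one_add_eq_compl, ← mul_assoc, mul_comm _ (0 * y), mul_compl_self, zero_mul_zero_mul]
    have h3 := add_mul_self (x * (1 + y)) (0 * y)
    rw [zero_mul_zero_mul, h'] at h3
    rw [h, h3]
  have h2 : x + 0 * y = x * (1 + y) + 0 * y := by
    rw [add_comm x, ← add_compl_mul, ← one_add_eq_compl, mul_comm x, add_comm]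
  rw [h2, h1, ← add_mul_self, mul_self, add_self]

theorem zero_mul_add (x y : α) : 0 * (x + y) = 0 * x * y := by
  rw [← mul_compl_self, compl_add, mul_assoc, mul_comm (x + y), compl_mul_add, ← mul_assoc,
    mul_compl_self, mul_comm xᶜ, ← mul_assoc, mul_comm y, mul_assoc, zero_mul_compl]

theorem zero_mul_add_zero_mul (x y : α) : 0 * x + 0 * y = 0 * (x + y) := by
  rw [← mul_one_add, one_add_eq_compl, mul_comm 0, ← mul_assoc, zero_mul_compl, zero_mul_zero_mul,
    zero_mul_add, mul_assoc, mul_comm x]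

theorem zero_mul_mul (x y : α) : 0 * (x * y) = 0 * x + 0 * y := by
  rw [zero_mul_add_zero_mul, zero_mul_add, mul_assoc]

theorem add_zero_mul_self (x : α) : x + 0 * x = x := by
  rw [← add_mul_self, mul_self, add_self]

/-- Adding an element equal to its own zero part is multiplication by its complement. -/
theorem mul_compl_of_zero_mul (x : α) {f : α} (hf : 0 * f = f) : x * fᶜ = x + f := by
  have h := mul_one_add x f
  rwa [one_add_eq_compl, hf] at h

theorem mul_add_absorb {x y : α} (h : 0 * x = 0 * y) : x * (x + y) = x := by
  rw [mul_add_self, mul_one_add, ← h, add_zero_mul_self]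

theorem add_mul_absorb {x y : α} (h : 0 * x = 0 * y) : x + x * y = x := by
  rw [add_mul_self, ← h, add_zero_mul_self]

/-! ### The index semilattice and the Boolean fibres. -/

variable (α) in
/-- The index semilattice of an involutive bisemilattice: the elements `0 * x`. -/
@[ext]
structure ZeroPart : Type u where
  val : α
  property : 0 * val = val

/-- The index of an element. -/
def zeroPart (x : α) : ZeroPart α := ⟨0 * x, zero_mul_zero_mul x⟩

theorem zero_mul_add_of_eq {e f : α} (he : 0 * e = e) (hf : 0 * f = f) : 0 * (e + f) = e + f := by
  rw [← zero_mul_add_zero_mul, he, hf]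

instance : SemilatticeSup (ZeroPart α) :=
  letI : Max (ZeroPart α) := ⟨fun e f => ⟨e.1 + f.1, zero_mul_add_of_eq e.2 f.2⟩⟩
  SemilatticeSup.mk' (fun e f => ZeroPart.ext (add_comm e.1 f.1))
    (fun e f g => ZeroPart.ext (add_assoc e.1 f.1 g.1).symm) (fun e => ZeroPart.ext (add_self e.1))

theorem ZeroPart.add_eq_of_le {e f : ZeroPart α} (h : e ≤ f) : e.1 + f.1 = f.1 :=
  congrArg ZeroPart.val (sup_eq_right.2 h)

instance : OrderBot (ZeroPart α) where
  bot := ⟨0, mul_self 0⟩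
  bot_le e := sup_eq_right.1 (ZeroPart.ext (zero_add e.1))

/-- The elements of a given index. -/
@[ext]
structure Fiber (e : ZeroPart α) : Type u where
  val : α
  property : 0 * val = e.1

namespace Fiber

variable {e : ZeroPart α}

theorem zero_mul_eq (x y : Fiber e) : 0 * x.1 = 0 * y.1 := x.2.trans y.2.symm

theorem add_index (x : Fiber e) : x.1 + e.1 = x.1 := by
  have h := add_zero_mul_self x.1
  rwa [x.2] at h

instance : Max (Fiber e) :=
  ⟨fun x y => ⟨x.1 + y.1, by rw [← zero_mul_add_zero_mul, x.2, y.2, add_self]⟩⟩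

instance : Min (Fiber e) :=
  ⟨fun x y => ⟨x.1 * y.1, by rw [zero_mul_mul, x.2, y.2, add_self]⟩⟩

instance : Compl (Fiber e) := ⟨fun x => ⟨x.1ᶜ, by rw [zero_mul_compl, x.2]⟩⟩

theorem coe_inf (x y : Fiber e) : (x ⊓ y).1 = x.1 * y.1 := rfl
theorem coe_compl (x : Fiber e) : xᶜ.1 = x.1ᶜ := rfl

instance : Lattice (Fiber e) :=
  Lattice.mk' (fun x y => Fiber.ext (add_comm x.1 y.1))
    (fun x y z => Fiber.ext (add_assoc x.1 y.1 z.1).symm)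
    (fun x y => Fiber.ext (mul_comm x.1 y.1))
    (fun x y z => Fiber.ext (mul_assoc x.1 y.1 z.1).symm)
    (fun x y => Fiber.ext (add_mul_absorb (zero_mul_eq x y)))
    (fun x y => Fiber.ext (mul_add_absorb (zero_mul_eq x y)))

theorem inf_compl_sup (x y : Fiber e) : x ⊓ (xᶜ ⊔ y) = x ⊓ y := Fiber.ext (mul_compl_add x.1 y.1)

theorem compl_sup_inf (x y : Fiber e) : xᶜ ⊔ x ⊓ y = xᶜ ⊔ y :=
  Fiber.ext (by
    have h := add_compl_mul x.1ᶜ y.1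
    rwa [compl_compl] at h)

/-- Half of the Heyting adjunction, obtained without distributivity; distributivity then follows, as
a map with a right adjoint preserves joins. -/
theorem le_compl_sup {x y z : Fiber e} (h : x ⊓ y ≤ z) : y ≤ xᶜ ⊔ z :=
  calc y ≤ xᶜ ⊔ y := le_sup_right
    _ = xᶜ ⊔ x ⊓ y := (compl_sup_inf x y).symm
    _ ≤ xᶜ ⊔ z := sup_le_sup_left h _

instance : DistribLattice (Fiber e) :=
  DistribLattice.ofInfSupLe fun x y z =>
    calc x ⊓ (y ⊔ z) ≤ x ⊓ (xᶜ ⊔ (x ⊓ y ⊔ x ⊓ z)) :=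
          inf_le_inf_left _ (sup_le (le_compl_sup le_sup_left) (le_compl_sup le_sup_right))
      _ = x ⊓ (x ⊓ y ⊔ x ⊓ z) := inf_compl_sup _ _
      _ ≤ x ⊓ y ⊔ x ⊓ z := inf_le_right

instance : BooleanAlgebra (Fiber e) where
  bot := ⟨e.1, e.2⟩
  top := ⟨e.1ᶜ, by rw [zero_mul_compl, e.2]⟩
  bot_le x := sup_eq_right.1 (Fiber.ext ((add_comm _ _).trans x.add_index))
  le_top x := inf_eq_left.1 (Fiber.ext ((mul_compl_of_zero_mul x.1 e.2).trans x.add_index))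
  inf_compl_le_bot x := le_of_eq (Fiber.ext ((mul_compl_self x.1).trans x.2))
  top_le_sup_compl x := le_of_eq (Fiber.ext (by
    change e.1ᶜ = x.1 + x.1ᶜ
    rw [← x.property, ← mul_compl_self, compl_mul, compl_compl, add_comm]))

/-- The transition map between the fibers. -/
def map {e f : ZeroPart α} (h : e ≤ f) (x : Fiber e) : Fiber f :=
  ⟨x.1 + f.1, by rw [← zero_mul_add_zero_mul, x.2, f.2, ZeroPart.add_eq_of_le h]⟩

theorem coe_map {e f : ZeroPart α} (h : e ≤ f) (x : Fiber e) : (map h x).1 = x.1 + f.1 := rfl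

theorem map_refl (x : Fiber e) : map le_rfl x = x := Fiber.ext x.add_index

theorem map_map {e f g : ZeroPart α} (h : e ≤ f) (h' : f ≤ g) (x : Fiber e) :
    map h' (map h x) = map (h.trans h') x :=
  Fiber.ext (by simp only [coe_map, ← add_assoc, ZeroPart.add_eq_of_le h'])

/-- Adding `f` is multiplying by the idempotent `fᶜ`, which distributes over products. -/
theorem map_inf {e f : ZeroPart α} (h : e ≤ f) (x y : Fiber e) :
    map h (x ⊓ y) = map h x ⊓ map h y :=
  Fiber.ext (by
    simp only [coe_map, coe_inf, ← mul_compl_of_zero_mul _ f.2]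
    calc x.1 * y.1 * f.1ᶜ = x.1 * y.1 * (f.1ᶜ * f.1ᶜ) := by rw [mul_self]
      _ = x.1 * f.1ᶜ * (y.1 * f.1ᶜ) := by ac_rfl)

theorem map_compl {e f : ZeroPart α} (h : e ≤ f) (x : Fiber e) : map h xᶜ = (map h x)ᶜ :=
  Fiber.ext (by simp only [coe_map, coe_compl, compl_add, mul_compl_of_zero_mul _ f.2])

end Fiber

/-- An element as a member of its fiber. -/
def toFiber (x : α) : Fiber (zeroPart x) := ⟨x, rfl⟩

end InvolutiveBisemilattice

/-- A map preserving addition, complement and zero preserves all the operations. -/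
def InvolutiveBisemilatticeHom.mk' {α β : Type u} [InvolutiveBisemilattice α]
    [InvolutiveBisemilattice β] (f : α → β) (add : ∀ x y, f (x + y) = f x + f y)
    (compl : ∀ x, f xᶜ = (f x)ᶜ) (zero : f 0 = 0) : InvolutiveBisemilatticeHom α β where
  toFun := f
  map_add := add
  map_mul x y := by
    simp only [InvolutiveBisemilattice.mul_eq, add, compl]
  map_compl := compl
  map_zero := zero
  map_one := by simp only [InvolutiveBisemilattice.one_eq, compl, zero]

/-- A bijective homomorphism is an isomorphism. -/
noncomputable def IBSL.isoOfBijective {A B : IBSL.{u}} (f : A ⟶ B)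
    (h : Function.Bijective f.toFun) : A ≅ B :=
  let e := Equiv.ofBijective f.toFun h
  have he (x : A.carrier) : e x = f.toFun x := rfl
  { hom := f
    inv := InvolutiveBisemilatticeHom.mk' e.symm
      (fun x y => by rw [e.symm_apply_eq, he, f.map_add, ← he, ← he]; simp)
      (fun x => by rw [e.symm_apply_eq, he, f.map_compl, ← he]; simp)
      (by rw [e.symm_apply_eq, he, f.map_zero])
    hom_inv_id := InvolutiveBisemilatticeHom.ext (funext e.symm_apply_apply)
    inv_hom_id := InvolutiveBisemilatticeHom.ext (funext e.apply_symm_apply) }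

open TopologicalSpace

/-! ### Stone duality for Boolean algebras. -/

section StoneDuality

/-- The Stone space of a Boolean algebra: its two-valued homomorphisms. -/
abbrev BoolCharacter (A : Type u) [BooleanAlgebra A] : Type u :=
  {χ : A → Bool // (∀ a b, χ (a ⊓ b) = (χ a && χ b)) ∧ ∀ a, χ aᶜ = !χ a}

namespace BoolCharacter

variable {A : Type u} [BooleanAlgebra A]

instance : CompactSpace (BoolCharacter A) := by
  have hS : IsClosed {χ : A → Bool | (∀ a b, χ (a ⊓ b) = (χ a && χ b)) ∧ ∀ a, χ aᶜ = !χ a} := by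
    simp only [Set.ofPred_and, Set.ofPred_forall]
    refine .inter (isClosed_iInter fun a => isClosed_iInter fun b => ?_)
      (isClosed_iInter fun a => ?_)
    · exact isClosed_eq (continuous_apply _) (Continuous.comp (g := fun p : Bool × Bool => p.1 && p.2)
        (f := fun χ : A → Bool => (χ a, χ b)) continuous_of_discreteTopology
        ((continuous_apply a).prodMk (continuous_apply b)))
    · exact isClosed_eq (continuous_apply _)
        (Continuous.comp (g := Bool.not) (f := fun χ : A → Bool => χ a)
          continuous_of_discreteTopology (continuous_apply a))
  exact isCompact_iff_compactSpace.1 hS.isCompact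

theorem map_inf (χ : BoolCharacter A) (a b : A) : χ.1 (a ⊓ b) = (χ.1 a && χ.1 b) := χ.2.1 a b

theorem map_compl (χ : BoolCharacter A) (a : A) : χ.1 aᶜ = !χ.1 a := χ.2.2 a

theorem map_sup (χ : BoolCharacter A) (a b : A) : χ.1 (a ⊔ b) = (χ.1 a || χ.1 b) := by
  rw [← compl_compl (a ⊔ b), map_compl, compl_sup, map_inf, map_compl, map_compl]
  simp

theorem map_bot (χ : BoolCharacter A) : χ.1 ⊥ = false := by
  rw [← inf_compl_self ⊤, map_inf, map_compl]
  simp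

theorem map_finset_inf (χ : BoolCharacter A) {ι : Type*} (s : Finset ι) (g : ι → A)
    (h : χ.1 (s.inf g)) {i : ι} (hi : i ∈ s) : χ.1 (g i) := by
  rw [← inf_eq_right.2 (Finset.inf_le hi : s.inf g ≤ g i), map_inf] at h
  simp_all

/-- The character is the indicator of the complement of a prime ideal containing `b` but not `a`. -/
theorem exists_of_not_le {a b : A} (h : ¬a ≤ b) : ∃ χ : BoolCharacter A, χ.1 a ∧ ¬χ.1 b := by
  classical
  obtain ⟨J, hJ, hbJ, haJ⟩ := DistribLattice.prime_ideal_of_disjoint_filter_ideal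
    (F := Order.PFilter.principal a) (I := Order.Ideal.principal b)
    (Set.disjoint_left.2 fun x hx hx' => h (le_trans (b := x) hx hx'))
  have hcompl (x : A) : xᶜ ∈ J ↔ x ∉ J := by
    refine ⟨fun hx hx' => hJ.top_notMem ?_, hJ.mem_or_compl_mem.resolve_left⟩
    have := J.sup_mem hx' hx
    rwa [sup_compl_eq_top] at this
  refine ⟨⟨fun x => decide (x ∉ J), fun x y => ?_, fun x => ?_⟩, ?_, ?_⟩
  · have : x ⊓ y ∈ J ↔ x ∈ J ∨ y ∈ J :=
      ⟨hJ.mem_or_mem, fun h => h.elim (J.lower inf_le_left) (J.lower inf_le_right)⟩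
    simp [this]
  · simp [hcompl]
  · simpa using Set.disjoint_left.1 haJ (le_refl a)
  · simpa using hbJ (le_refl b)

/-- The clopen set of characters defined by an element. -/
def basic (a : A) : Clopens (BoolCharacter A) where
  carrier := {χ | χ.1 a}
  isClopen' := (isClopen_discrete {true}).preimage
    ((continuous_apply a).comp continuous_subtype_val)

theorem mem_basic {χ : BoolCharacter A} {a : A} : χ ∈ basic a ↔ χ.1 a := Iff.rfl

theorem basic_sup (a b : A) : basic (a ⊔ b) = basic a ⊔ basic b :=
  SetLike.ext fun χ => by
    change χ.1 (a ⊔ b) ↔ χ.1 a ∨ χ.1 b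
    simp [map_sup]

theorem basic_compl (a : A) : basic aᶜ = (basic a)ᶜ :=
  SetLike.ext fun χ => by
    change χ.1 aᶜ ↔ ¬χ.1 a
    simp [map_compl]

theorem basic_bot : basic (⊥ : A) = ⊥ :=
  SetLike.ext fun χ => by
    change χ.1 ⊥ ↔ False
    simp [map_bot]

theorem basic_injective : Function.Injective (basic (A := A)) := by
  have key {a b : A} (h : basic a = basic b) : a ≤ b := by
    by_contra hab
    obtain ⟨χ, h1, h2⟩ := exists_of_not_le hab
    exact h2 (mem_basic.1 (h ▸ mem_basic.2 h1))
  exact fun a b h => le_antisymm (key h) (key h.symm)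

theorem exists_basic_subset {W : Set (BoolCharacter A)} (hW : IsOpen W) {χ : BoolCharacter A}
    (hχ : χ ∈ W) : ∃ a, χ ∈ basic a ∧ (basic a : Set (BoolCharacter A)) ⊆ W := by
  classical
  obtain ⟨O, hO, rfl⟩ := isOpen_induced_iff.1 hW
  obtain ⟨s, t, hst, hsub⟩ := isOpen_pi_iff.1 hO χ.1 hχ
  have hval (ψ : BoolCharacter A) (i : A) :
      ψ.1 (if χ.1 i then i else iᶜ) ↔ ψ.1 i = χ.1 i := by
    split_ifs with h <;> simp_all [map_compl]
  -- This meet forces agreement with `χ` at the finitely many coordinates restricted by the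
  -- neighbourhood.
  refine ⟨s.inf fun i => if χ.1 i then i else iᶜ, ?_, fun ψ hψ => hsub fun i hi => ?_⟩
  · refine mem_basic.2 (Finset.inf_induction (p := fun a => (χ.1 a : Prop)) ?_ ?_ fun i _ => ?_)
    · rw [← compl_bot, map_compl, map_bot]; rfl
    · intro a ha b hb
      simp_all [map_inf]
    · exact (hval χ i).2 rfl
  · rw [(hval ψ i).1 (ψ.map_finset_inf s _ hψ hi)]
    exact (hst i hi).2

theorem basic_surjective : Function.Surjective (basic (A := A)) := by
  intro W
  choose! g hg hsub using fun χ (hχ : χ ∈ W) => exists_basic_subset W.isOpen hχ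
  obtain ⟨s, hs, hcov⟩ := W.isClosed.isCompact.elim_nhds_subcover
    (fun χ => (basic (g χ) : Set (BoolCharacter A)))
    (fun χ hχ => (basic (g χ)).isOpen.mem_nhds (hg χ hχ))
  have hsup : basic (s.sup g) = s.sup fun χ => basic (g χ) :=
    Finset.apply_sup_eq_sup_comp basic basic_sup basic_bot
  refine ⟨s.sup g, Clopens.ext ?_⟩
  rw [hsup, Clopens.coe_finset_sup]
  exact (Set.iUnion₂_subset fun χ hχ => hsub χ (hs χ hχ)).antisymm hcov

/-- The continuous map induced by a homomorphism of Boolean algebras. -/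
def comap {B : Type u} [BooleanAlgebra B] (g : A → B) (inf : ∀ a b, g (a ⊓ b) = g a ⊓ g b)
    (compl : ∀ a, g aᶜ = (g a)ᶜ) : C(BoolCharacter B, BoolCharacter A) where
  toFun χ := ⟨fun a => χ.1 (g a), fun a b => by simp only [inf, map_inf],
    fun a => by simp only [compl, map_compl]⟩
  continuous_toFun := Continuous.subtype_mk (f := fun (χ : BoolCharacter B) a => χ.1 (g a))
    (continuous_pi fun a => (continuous_apply (g a)).comp continuous_subtype_val) _

end BoolCharacter

variable {X Y : Type*} [TopologicalSpace X] [TopologicalSpace Y]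
  [CompactSpace Y] [T2Space Y] [TotallyDisconnectedSpace Y]

theorem eq_of_forall_mem_clopens {y z : Y} (h : ∀ V : Clopens Y, y ∈ V → z ∈ V) : y = z := by
  by_contra hyz
  obtain ⟨V, hV, hy, hVz⟩ := compact_exists_isClopen_in_isOpen
    (isOpen_compl_singleton (x := z)) (show y ∈ ({z} : Set Y)ᶜ from hyz)
  exact hVz (h ⟨V, hV⟩ hy) rfl

/-- Every homomorphism between algebras of clopen sets is induced by a continuous map. -/
theorem exists_continuousMap_of_clopens (g : Clopens Y → Clopens X)
    (inf : ∀ a b, g (a ⊓ b) = g a ⊓ g b) (compl : ∀ a, g aᶜ = (g a)ᶜ) :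
    ∃ f : C(X, Y), ∀ x V, f x ∈ V ↔ x ∈ g V := by
  have hbot : g ⊥ = ⊥ := by rw [← inf_compl_self ⊤, inf, compl, inf_compl_self]
  -- The clopens `V` with `x ∈ g V` are nonempty and closed under intersection, so compactness gives
  -- a common point.
  have hex (x : X) : ∃ y, ∀ V : Clopens Y, x ∈ g V → y ∈ V := by
    have hne : (⋂ V : {V : Clopens Y // x ∈ g V}, (V.1 : Set Y)).Nonempty := by
      have : Nonempty {V : Clopens Y // x ∈ g V} := by
        refine ⟨⊤, ?_⟩
        rw [← compl_bot, compl, hbot, compl_bot]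
        trivial
      refine IsCompact.nonempty_iInter_of_directed_nonempty_isCompact_isClosed _ ?_ ?_
        (fun V => V.1.isClosed.isCompact) (fun V => V.1.isClosed)
      · intro V W
        refine ⟨⟨V.1 ⊓ W.1, ?_⟩, Set.inter_subset_left, Set.inter_subset_right⟩
        rw [inf]
        exact ⟨V.2, W.2⟩
      · intro V
        by_contra hV
        have h0 : V.1 = ⊥ := Clopens.ext (Set.not_nonempty_iff_eq_empty.1 hV)
        have := V.2
        rw [h0, hbot] at this
        exact this
    obtain ⟨y, hy⟩ := hne
    exact ⟨y, fun V hV => Set.mem_iInter.1 hy ⟨V, hV⟩⟩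
  choose f hf using hex
  have hiff (x : X) (V : Clopens Y) : f x ∈ V ↔ x ∈ g V := by
    refine ⟨fun h => ?_, hf x V⟩
    by_contra hx
    exact hf x Vᶜ (by rw [compl]; exact hx) h
  refine ⟨⟨f, ?_⟩, hiff⟩
  refine (isTopologicalBasis_isClopen (X := Y)).continuous_iff.2 fun V hV => ?_
  have : f ⁻¹' V = g ⟨V, hV⟩ := Set.ext fun x => hiff x ⟨V, hV⟩
  rw [this]
  exact (g ⟨V, hV⟩).isOpen

end StoneDuality

/-! ### The Płonka sum functor is fully faithful. -/

namespace SemInv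

/-- The elements of the Płonka sum of the algebras of clopen sets of an inverse system. -/
abbrev ClopenSum (X : SemInv.{u, u, u + 1} Profinite.{u}) : Type u :=
  Σ i : X.Index, Clopens (X.obj i)

variable {X Y Z : SemInv.{u, u, u + 1} Profinite.{u}}

/-- The preimage of a clopen set under a bonding map. -/
def pull (X : SemInv.{u, u, u + 1} Profinite.{u}) {i j : X.Index} (h : i ≤ j)
    (U : Clopens (X.obj i)) : Clopens (X.obj j) where
  carrier := {x | X.bond h x ∈ U}
  isClopen' := U.isClopen.preimage (X.bond h).hom.hom.continuous

theorem mem_pull {i j : X.Index} (h : i ≤ j) (U : Clopens (X.obj i)) (x : X.obj j) :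
    x ∈ X.pull h U ↔ X.bond h x ∈ U := Iff.rfl

theorem pull_refl {i : X.Index} (U : Clopens (X.obj i)) : X.pull le_rfl U = U :=
  SetLike.ext fun x => by rw [mem_pull, bond_refl]; rfl

theorem pull_pull {i j k : X.Index} (h : i ≤ j) (h' : j ≤ k) (U : Clopens (X.obj i)) :
    X.pull h' (X.pull h U) = X.pull (h.trans h') U :=
  SetLike.ext fun x => by rw [mem_pull, mem_pull, mem_pull, ← X.bond_trans h h']; rfl

theorem pull_sup {i j : X.Index} (h : i ≤ j) (U V : Clopens (X.obj i)) :
    X.pull h (U ⊔ V) = X.pull h U ⊔ X.pull h V := rfl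

theorem pull_inf {i j : X.Index} (h : i ≤ j) (U V : Clopens (X.obj i)) :
    X.pull h (U ⊓ V) = X.pull h U ⊓ X.pull h V := rfl

theorem pull_compl {i j : X.Index} (h : i ≤ j) (U : Clopens (X.obj i)) :
    X.pull h Uᶜ = (X.pull h U)ᶜ := rfl

theorem pull_bot {i j : X.Index} (h : i ≤ j) : X.pull h (⊥ : Clopens (X.obj i)) = ⊥ := rfl

namespace ClopenSum

/-- Pulling back along the equality of indices replaces a cast between fibres. -/
theorem ext {a b : ClopenSum X} (h : a.1 = b.1) (h' : X.pull h.le a.2 = b.2) : a = b := by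
  obtain ⟨i, U⟩ := a
  obtain ⟨j, V⟩ := b
  obtain rfl : i = j := h
  rw [pull_refl] at h'
  exact congrArg (Sigma.mk i) h'

instance : Add (ClopenSum X) :=
  ⟨fun a b => ⟨a.1 ⊔ b.1, X.pull le_sup_left a.2 ⊔ X.pull le_sup_right b.2⟩⟩

instance : Mul (ClopenSum X) :=
  ⟨fun a b => ⟨a.1 ⊔ b.1, X.pull le_sup_left a.2 ⊓ X.pull le_sup_right b.2⟩⟩

instance : Compl (ClopenSum X) := ⟨fun a => ⟨a.1, a.2ᶜ⟩⟩

instance : Zero (ClopenSum X) := ⟨⟨⊥, ⊥⟩⟩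

instance : One (ClopenSum X) := ⟨⟨⊥, ⊤⟩⟩

theorem add_def (a b : ClopenSum X) :
    a + b = ⟨a.1 ⊔ b.1, X.pull le_sup_left a.2 ⊔ X.pull le_sup_right b.2⟩ := rfl

theorem mul_def (a b : ClopenSum X) :
    a * b = ⟨a.1 ⊔ b.1, X.pull le_sup_left a.2 ⊓ X.pull le_sup_right b.2⟩ := rfl

theorem compl_def (a : ClopenSum X) : aᶜ = ⟨a.1, a.2ᶜ⟩ := rfl

theorem zero_def : (0 : ClopenSum X) = ⟨⊥, ⊥⟩ := rfl

instance : InvolutiveBisemilattice (ClopenSum X) where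
  add_self a := ext (sup_idem _) (by simp only [add_def, pull_pull, pull_refl, sup_idem])
  add_comm a b := ext (sup_comm _ _) (by
    simp only [add_def, pull_sup, pull_pull]
    exact sup_comm _ _)
  add_assoc a b c := ext (sup_assoc _ _ _).symm (by
    simp only [add_def, pull_sup, pull_pull]
    exact (sup_assoc _ _ _).symm)
  compl_compl a := by simp only [compl_def, compl_compl]
  mul_eq a b := by
    simp only [mul_def, add_def, compl_def, pull_compl, compl_sup, compl_compl]
  mul_compl_add a b := ext (sup_left_idem _ _) (by
    simp only [add_def, mul_def, compl_def, pull_sup, pull_inf, pull_pull, pull_compl]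
    rw [inf_sup_left, inf_compl_self, bot_sup_eq])
  zero_add a := ext (bot_sup_eq _) (by
    simp only [add_def, zero_def, pull_pull, pull_bot, bot_sup_eq, pull_refl])
  one_eq := congrArg (Sigma.mk ⊥) compl_bot.symm

theorem mk_mul_mk {i : X.Index} (U V : Clopens (X.obj i)) :
    (⟨i, U⟩ * ⟨i, V⟩ : ClopenSum X) = ⟨i, U ⊓ V⟩ :=
  ext (sup_idem _) (by simp only [mul_def, pull_inf, pull_pull, pull_refl])

theorem mk_add_bot {i j : X.Index} (h : i ≤ j) (U : Clopens (X.obj i)) :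
    (⟨i, U⟩ + ⟨j, ⊥⟩ : ClopenSum X) = ⟨j, X.pull h U⟩ :=
  ext (sup_eq_right.2 h) (by simp only [add_def, pull_pull, pull_bot, sup_bot_eq])

theorem mul_compl_self (a : ClopenSum X) : a * aᶜ = ⟨a.1, ⊥⟩ := by
  obtain ⟨i, U⟩ := a
  rw [compl_def, mk_mul_mk, inf_compl_self]

end ClopenSum

/-- The preimage of a clopen set under a component of a morphism. -/
def Hom.pull (f : X ⟶ Y) {j : Y.Index} (V : Clopens (Y.obj j)) :
    Clopens (X.obj (Hom.index f j)) where
  carrier := {x | Hom.app f j x ∈ V}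
  isClopen' := V.isClopen.preimage (Hom.app f j).hom.hom.continuous

theorem Hom.mem_pull (f : X ⟶ Y) {j : Y.Index} (V : Clopens (Y.obj j)) (x) :
    x ∈ Hom.pull f V ↔ Hom.app f j x ∈ V := Iff.rfl

theorem Hom.pull_pull (f : X ⟶ Y) {j k : Y.Index} (h : j ≤ k) (V : Clopens (Y.obj j)) :
    Hom.pull f (Y.pull h V) = X.pull (OrderHomClass.mono (Hom.index f) h) (Hom.pull f V) :=
  SetLike.ext fun x => by
    have := ConcreteCategory.congr_hom (Hom.naturality f h) x
    rw [Hom.mem_pull, SemInv.mem_pull, SemInv.mem_pull, Hom.mem_pull]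
    exact iff_of_eq (congrArg (· ∈ V) this.symm)

/-- The homomorphism of Płonka sums induced by a morphism of inverse systems. -/
def Hom.clopenSumMap (f : X ⟶ Y) : InvolutiveBisemilatticeHom (ClopenSum Y) (ClopenSum X) :=
  .mk' (fun a => ⟨Hom.index f a.1, Hom.pull f a.2⟩)
    (fun a b => ClopenSum.ext (map_sup (Hom.index f) _ _) (by
      change X.pull _ (Hom.pull f (Y.pull _ a.2) ⊔ Hom.pull f (Y.pull _ b.2)) = _
      rw [SemInv.pull_sup, Hom.pull_pull, Hom.pull_pull, SemInv.pull_pull, SemInv.pull_pull]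
      rfl))
    (fun _ => rfl)
    (ClopenSum.ext (map_bot (Hom.index f)) rfl)

/-- The Płonka sum functor. -/
def clopenSumFunctor : SemInv.{u, u, u + 1} Profinite.{u} ⥤ IBSL.{u}ᵒᵖ where
  obj X := .op ⟨ClopenSum X⟩
  map f := Quiver.Hom.op (show IBSL.mk (ClopenSum _) ⟶ IBSL.mk (ClopenSum _) from
    Hom.clopenSumMap f)
  map_id _ := rfl
  map_comp _ _ := rfl

theorem clopenSumMap_injective : Function.Injective (Hom.clopenSumMap (X := X) (Y := Y)) := by
  intro f g h
  have hval (j : Y.Index) (V : Clopens (Y.obj j)) :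
      (⟨Hom.index f j, Hom.pull f V⟩ : ClopenSum X) = ⟨Hom.index g j, Hom.pull g V⟩ :=
    congrFun (congrArg InvolutiveBisemilatticeHom.toFun h) ⟨j, V⟩
  have hindex : Hom.index f = Hom.index g := DFunLike.ext _ _ fun j => congrArg Sigma.fst (hval j ⊥)
  obtain ⟨φ, f, hf⟩ := f
  obtain ⟨ψ, g, hg⟩ := g
  obtain rfl : φ = ψ := hindex
  refine Hom.ext rfl (heq_of_eq (funext fun j => ?_))
  refine ConcreteCategory.hom_ext _ _ fun x => eq_of_forall_mem_clopens fun V hV => ?_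
  have h1 := eq_of_heq (Sigma.mk.inj (hval j V)).2
  exact (SetLike.ext_iff.1 h1 x).1 hV

theorem clopenSumMap_surjective : Function.Surjective (Hom.clopenSumMap (X := X) (Y := Y)) := by
  intro h
  -- As `a * aᶜ` is the bottom of the fibre of `a`, each fibre is sent into a single fibre.
  have hfst (j : Y.Index) (V : Clopens (Y.obj j)) :
      (⟨(h.toFun ⟨j, V⟩).1, ⊥⟩ : ClopenSum X) = h.toFun ⟨j, ⊥⟩ := by
    rw [← ClopenSum.mul_compl_self, ← h.map_compl, ← h.map_mul, ClopenSum.mul_compl_self]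
  let φ : SupBotHom Y.Index X.Index :=
    { toFun := fun j => (h.toFun ⟨j, ⊥⟩).1
      map_sup' := fun j k => by
        have := congrArg Sigma.fst (h.map_add ⟨j, ⊥⟩ ⟨k, ⊥⟩)
        simpa only [ClopenSum.add_def, pull_bot, sup_bot_eq] using this
      map_bot' := congrArg Sigma.fst h.map_zero }
  have hex (j : Y.Index) (V : Clopens (Y.obj j)) :
      ∃ U : Clopens (X.obj (φ j)), h.toFun ⟨j, V⟩ = ⟨φ j, U⟩ := by
    have h1 := congrArg Sigma.fst (hfst j V)
    have : (h.toFun ⟨j, V⟩).1 = φ j := h1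
    exact ⟨X.pull this.le (h.toFun ⟨j, V⟩).2, ClopenSum.ext this rfl⟩
  choose g hg using hex
  have ginf (j : Y.Index) (V W : Clopens (Y.obj j)) : g j (V ⊓ W) = g j V ⊓ g j W := by
    have := h.map_mul ⟨j, V⟩ ⟨j, W⟩
    rw [ClopenSum.mk_mul_mk, hg, hg, hg, ClopenSum.mk_mul_mk] at this
    exact eq_of_heq (Sigma.mk.inj this).2
  have gcompl (j : Y.Index) (V : Clopens (Y.obj j)) : g j Vᶜ = (g j V)ᶜ := by
    have := h.map_compl ⟨j, V⟩
    rw [ClopenSum.compl_def, hg, hg, ClopenSum.compl_def] at this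
    exact eq_of_heq (Sigma.mk.inj this).2
  have gbot (j : Y.Index) : g j ⊥ = ⊥ := by
    rw [← inf_compl_self ⊤, ginf, gcompl, inf_compl_self]
  -- Pulling back to `k` is adding `⟨k, ⊥⟩`, an operation that `h` preserves.
  have gpull {j k : Y.Index} (hjk : j ≤ k) (V : Clopens (Y.obj j)) :
      g k (Y.pull hjk V) = X.pull (OrderHomClass.mono φ hjk) (g j V) := by
    have := h.map_add ⟨j, V⟩ ⟨k, ⊥⟩
    rw [ClopenSum.mk_add_bot hjk, hg, hg, hg, gbot,
      ClopenSum.mk_add_bot (OrderHomClass.mono φ hjk)] at this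
    exact eq_of_heq (Sigma.mk.inj this).2
  choose f hf using fun j => exists_continuousMap_of_clopens (g j) (ginf j) (gcompl j)
  let F : X ⟶ Y :=
    { index := φ
      app := fun j => CompHausLike.ofHom _ (f j)
      naturality := fun {j k} hjk => ConcreteCategory.hom_ext _ _ fun x =>
        eq_of_forall_mem_clopens fun V hV => by
          have h1 := (hf j _ V).1 hV
          have h2 : x ∈ g k (Y.pull hjk V) := by rw [gpull]; exact h1
          exact (hf k x _).2 h2 }
  refine ⟨F, InvolutiveBisemilatticeHom.ext (funext fun ⟨j, V⟩ => ?_)⟩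
  rw [hg]
  exact congrArg (Sigma.mk (φ j)) (SetLike.ext fun x => hf j x V)

instance : clopenSumFunctor.{u}.Faithful where
  map_injective h := clopenSumMap_injective (congrArg Quiver.Hom.unop h)

instance : clopenSumFunctor.{u}.Full where
  map_surjective h :=
    let ⟨f, hf⟩ := clopenSumMap_surjective h.unop
    ⟨f, congrArg Quiver.Hom.op hf⟩

end SemInv

/-! ### Essential surjectivity by Stone representation of the fibres. -/

namespace InvolutiveBisemilattice

variable (α : Type u) [InvolutiveBisemilattice α]

/-- The inverse system of the Stone spaces of the fibers of an involutive bisemilattice. -/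
def stoneSystem : SemInv.{u, u, u + 1} Profinite.{u} where
  Index := ZeroPart α
  obj e := Profinite.of (BoolCharacter (Fiber e))
  bond h := CompHausLike.ofHom _
    (BoolCharacter.comap (Fiber.map h) (Fiber.map_inf h) (Fiber.map_compl h))
  bond_refl _ := ConcreteCategory.hom_ext _ _ fun χ =>
    Subtype.ext (funext fun a => congrArg χ.1 (Fiber.map_refl a))
  bond_trans h h' := ConcreteCategory.hom_ext _ _ fun χ =>
    Subtype.ext (funext fun a => congrArg χ.1 (Fiber.map_map h h' a))

variable {α}

theorem sigma_basic_toFiber {x : α} {e : ZeroPart α} (a : Fiber e) (h : a.1 = x) :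
    (⟨zeroPart x, BoolCharacter.basic (toFiber x)⟩ : (stoneSystem α).ClopenSum) =
      ⟨e, BoolCharacter.basic a⟩ := by
  obtain ⟨y, hy⟩ := a
  obtain rfl : y = x := h
  obtain rfl : zeroPart y = e := ZeroPart.ext hy
  rfl

/-- Moving to the common fibre adds only `0 * (x + y)`, which `x + y` absorbs. -/
theorem add_eq_map_sup_map (x y : α) :
    (Fiber.map (le_sup_left : zeroPart x ≤ zeroPart x ⊔ zeroPart y) (toFiber x) ⊔
      Fiber.map le_sup_right (toFiber y)).1 = x + y :=
  calc x + (0 * x + 0 * y) + (y + (0 * x + 0 * y)) = x + y + ((0 * x + 0 * y) + (0 * x + 0 * y)) := by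
        ac_rfl
    _ = x + y := by rw [add_self, zero_mul_add_zero_mul, add_zero_mul_self]

/-- The comparison of an involutive bisemilattice with the Płonka sum of the clopen algebras
of its Stone spaces. -/
def toClopenSum : InvolutiveBisemilatticeHom α (stoneSystem α).ClopenSum :=
  .mk' (fun x => ⟨zeroPart x, BoolCharacter.basic (toFiber x)⟩)
    (fun x y => (sigma_basic_toFiber _ (add_eq_map_sup_map x y)).trans
      (congrArg (Sigma.mk (zeroPart x ⊔ zeroPart y)) (BoolCharacter.basic_sup _ _)))
    (fun x => (sigma_basic_toFiber (toFiber x)ᶜ rfl).trans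
      (congrArg (Sigma.mk (zeroPart x)) (BoolCharacter.basic_compl _)))
    ((sigma_basic_toFiber (⊥ : Fiber (⊥ : ZeroPart α)) rfl).trans
      (congrArg (Sigma.mk (⊥ : ZeroPart α)) BoolCharacter.basic_bot))

theorem toClopenSum_bijective : Function.Bijective (toClopenSum (α := α)).toFun := by
  constructor
  · intro x y h
    -- Free indices `e` and `f` allow their equality to be substituted.
    have key {e f : ZeroPart α} {a : Fiber e} {b : Fiber f}
        (h : (⟨e, BoolCharacter.basic a⟩ : (stoneSystem α).ClopenSum) =
          ⟨f, BoolCharacter.basic b⟩) : a.1 = b.1 := by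
      obtain ⟨rfl, h⟩ := Sigma.mk.inj h
      rw [BoolCharacter.basic_injective (eq_of_heq h)]
    exact key h
  · intro ⟨(e : ZeroPart α), W⟩
    obtain ⟨a, rfl⟩ := BoolCharacter.basic_surjective (A := Fiber e) W
    exact ⟨a.1, sigma_basic_toFiber a rfl⟩

end InvolutiveBisemilattice

instance : SemInv.clopenSumFunctor.{u}.EssSurj where
  mem_essImage A := ⟨InvolutiveBisemilattice.stoneSystem A.unop.carrier, ⟨Iso.op
    (IBSL.isoOfBijective (A := A.unop) (B := ⟨_⟩) InvolutiveBisemilattice.toClopenSum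
      InvolutiveBisemilattice.toClopenSum_bijective)⟩⟩

instance : SemInv.clopenSumFunctor.{u}.IsEquivalence where

theorem mainTheorem1 :
    Nonempty (IBSL.{u}ᵒᵖ ≌ SemInv.{u, u, u + 1} Profinite.{u}) :=
  ⟨SemInv.clopenSumFunctor.asEquivalence.symm⟩
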